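/- An access structure on $\{1,\dots,7\}$ is a family of accepted sets of participants that is closed under supersets. A secret sharing scheme for it is a joint distribution $(s_0,s_1,\dots,s_7)$ of random variables with finite ranges and Shannon entropy $H(s_0)>0$ such that, for every $J\subseteq\{1,\dots,7\}$ and $s_J=(s_j)_{j\in J}$, one has $H(s_0\mid s_J)=0$ if $J$ is accepted and $H(s_0\mid s_J)=H(s_0)$ if $J$ is not accepted. The information ratio of the scheme is $\max_{1\le i\le 7}H(s_i)/H(s_0)$, and the (optimal) information ratio of the access structure is the infimum of the information ratios of all its schemes. Consider the following seven access structures on $\{1,\dots,7\}$, each given by its minimal accepted sets (where $123$ means $\{1,2,3\}$, etc.): - $\mathcal A$: $123, 145, 167, 246, 257, 347, 356, 1247$; - $\mathcal A^*$: $123, 145, 167, 246, 257, 347, 1356, 2356, 3456, 3567$; - $\mathcal F$: $123, 145, 167, 246, 257, 347, 356, 1247, 1256$; - $\mathcal F^*$: $123, 145, 167, 246, 257, 1347, 1356, 2347, 2356, 3456, 3457, 3467, 3567$; - $\widehat{\mathcal F}$: $123, 145, 167, 246, 257, 347, 1256, 1356, 2356, 3456, 3567$; - $\mathcal Q$: $123,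 145, 167, 246, 257, 347, 1247, 1256, 1356, 2356, 3456, 3567$; - $\mathcal Q^*$: $123, 145, 167, 246, 257, 1247, 1347, 1356, 2347, 2356, 3456, 3457, 3467, 3567$. Their optimal information ratios satisfy the lower bounds $$\mathcal A\ge\tfrac{57}{50},\quad \mathcal A^*\ge\tfrac{52}{45},\quad \mathcal F\ge\tfrac{17}{15},\quad \mathcal F^*\ge\tfrac{8}{7},\quad \widehat{\mathcal F}\ge\tfrac{23}{20},\quad \mathcal Q\ge\tfrac{17}{15},\quad \mathcal Q^*\ge\tfrac{8}{7}.$$ -/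

import Mathlib

open scoped BigOperators

noncomputable section

namespace SecretSharing

/-- Shannon entropy (in nats) of a probability distribution on a finite set. -/
def entropy {α : Type*} [Fintype α] (p : PMF α) : ℝ :=
  ∑ a, Real.negMulLog (p a).toReal

/-- An access structure among `n` participants: a monotone division of all sets of participants
into accepted and not accepted ones. The participants are `0, …, n - 1` here; in a scheme the share
of participant `i` has the index `i.succ`, and the index `0` belongs to the secret. -/
structure AccessStructure (n : ℕ) where
  accepted : Set (Finset (Fin n))
  monotone : ∀ J K : Finset (Fin n), J ⊆ K → J ∈ accepted → K ∈ accepted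

/-- A joint distribution of finitely many random variables `s i` with finite ranges. -/
structure JointDistribution (ι : Type) where
  range : ι → Type
  finite : ∀ i, Fintype (range i)
  law : PMF (∀ i, range i)

attribute [instance] JointDistribution.finite

namespace JointDistribution

variable {ι : Type} [DecidableEq ι]

/-- The law of the sub-tuple `(s i)` for `i ∈ I`. -/
def marginal (s : JointDistribution ι) (I : Finset ι) : PMF (∀ i : I, s.range i) :=
  s.law.map fun x i => x i

/-- The joint entropy `H(s_I)`, i.e. the component `h_I` of the entropy vector. -/
def H (s : JointDistribution ι) (I : Finset ι) : ℝ :=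
  entropy (s.marginal I)

/-- The conditional entropy `H(s_I | s_J) = H(s_I, s_J) - H(s_J)`. -/
def condH (s : JointDistribution ι) (I J : Finset ι) : ℝ :=
  s.H (I ∪ J) - s.H J

end JointDistribution

/-- A secret sharing scheme for the access structure `A`: a joint distribution of the secret
`s 0` and of the shares `s 1, …, s n`, where the secret is not almost surely constant, accepted sets
determine the secret, and sets that are not accepted have no information on it. -/
structure Scheme {n : ℕ} (A : AccessStructure n) extends JointDistribution (Fin (n + 1)) where
  secret_pos : 0 < toJointDistribution.H {0}
  of_accepted : ∀ J : Finset (Fin n), J ∈ A.accepted →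
    toJointDistribution.condH {0} (J.map (Fin.succEmb n)) = 0
  of_not_accepted : ∀ J : Finset (Fin n), J ∉ A.accepted →
    toJointDistribution.condH {0} (J.map (Fin.succEmb n)) = toJointDistribution.H {0}

/-- The information ratio `max_i H(s_i) / H(s_0)` of a scheme. -/
def Scheme.informationRatio {n : ℕ} {A : AccessStructure n} (s : Scheme A) : ℝ :=
  ⨆ i : Fin n, s.H {i.succ} / s.H {0}

namespace AccessStructure

/-- The optimal information ratio of an access structure: the infimum of the information ratios of
its schemes (in the extended reals, so that no convention on the infimum is needed). -/
def informationRatio {n : ℕ} (A : AccessStructure n) : EReal :=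
  ⨅ s : Scheme A, (s.informationRatio : EReal)

/-- The access structure with a given list of minimal accepted sets, written with the labels
`1, …, n` of the shares: a set is accepted if and only if it includes a set of the list. -/
def ofMinimal {n : ℕ} (M : Finset (Finset (Fin (n + 1)))) : AccessStructure n where
  accepted := {J | ∃ m ∈ M, m ⊆ J.map (Fin.succEmb n)}
  monotone := fun _ _ hJK ⟨m, hm, hmJ⟩ =>
    ⟨m, hm, hmJ.trans (Finset.map_subset_map.mpr hJK)⟩

/-- The access structure `𝒜`. -/
def portA : AccessStructure 7 := ofMinimal
  {{1, 2, 3}, {1, 4, 5}, {1, 6, 7}, {2, 4, 6}, {2, 5, 7}, {3, 4, 7}, {3, 5, 6}, {1, 2, 4, 7}}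

/-- The access structure `𝒜*`. -/
def portAStar : AccessStructure 7 := ofMinimal
  {{1, 2, 3}, {1, 4, 5}, {1, 6, 7}, {2, 4, 6}, {2, 5, 7}, {3, 4, 7},
    {1, 3, 5, 6}, {2, 3, 5, 6}, {3, 4, 5, 6}, {3, 5, 6, 7}}

/-- The access structure `ℱ`. -/
def portF : AccessStructure 7 := ofMinimal
  {{1, 2, 3}, {1, 4, 5}, {1, 6, 7}, {2, 4, 6}, {2, 5, 7}, {3, 4, 7}, {3, 5, 6},
    {1, 2, 4, 7}, {1, 2, 5, 6}}

/-- The access structure `ℱ*`. -/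
def portFStar : AccessStructure 7 := ofMinimal
  {{1, 2, 3}, {1, 4, 5}, {1, 6, 7}, {2, 4, 6}, {2, 5, 7},
    {1, 3, 4, 7}, {1, 3, 5, 6}, {2, 3, 4, 7}, {2, 3, 5, 6},
    {3, 4, 5, 6}, {3, 4, 5, 7}, {3, 4, 6, 7}, {3, 5, 6, 7}}

/-- The access structure `ℱ̂`. -/
def portFHat : AccessStructure 7 := ofMinimal
  {{1, 2, 3}, {1, 4, 5}, {1, 6, 7}, {2, 4, 6}, {2, 5, 7}, {3, 4, 7},
    {1, 2, 5, 6}, {1, 3, 5, 6}, {2, 3, 5, 6}, {3, 4, 5, 6}, {3, 5, 6, 7}}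

/-- The access structure `𝒬`. -/
def portQ : AccessStructure 7 := ofMinimal
  {{1, 2, 3}, {1, 4, 5}, {1, 6, 7}, {2, 4, 6}, {2, 5, 7}, {3, 4, 7},
    {1, 2, 4, 7}, {1, 2, 5, 6}, {1, 3, 5, 6}, {2, 3, 5, 6}, {3, 4, 5, 6}, {3, 5, 6, 7}}

/-- The access structure `𝒬*`. -/
def portQStar : AccessStructure 7 := ofMinimal
  {{1, 2, 3}, {1, 4, 5}, {1, 6, 7}, {2, 4, 6}, {2, 5, 7},
    {1, 2, 4, 7}, {1, 3, 4, 7}, {1, 3, 5, 6}, {2, 3, 4, 7}, {2, 3, 5, 6},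
    {3, 4, 5, 6}, {3, 4, 5, 7}, {3, 4, 6, 7}, {3, 5, 6, 7}}

end AccessStructure

end SecretSharing

end

/-!
Lower bounds for information ratios by linear programming with copied random variables.

The joint entropies of the secret and the shares of a scheme satisfy the Shannon inequalities, that
is, all conditional mutual informations are nonnegative, and the equations which express that the
scheme realizes the access structure. These linear constraints alone give bounds that are too weak.
Stronger ones come from the copy lemma: for sets `X` and `Y` of the variables, there is a larger
family of random variables with a copy `Y'` of `Y` such that `(X, Y')` has the law of `(X, Y)` and
`Y'` is independent of all old variables given `X`. Every Shannon inequality for the larger family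
has consequences for the old entropies, and these need not follow from the old Shannon
inequalities.

For each of the seven access structures one or two copy steps suffice. An explicit nonnegative
integral combination of conditional mutual informations in the larger family equals
`∑ wᵢ H(sᵢ) - b H(s₀)`. Since it is nonnegative, `b H(s₀) ≤ ∑ wᵢ H(sᵢ) ≤ (∑ wᵢ) ρ H(s₀)` for the
information ratio `ρ`, hence `ρ ≥ b / ∑ wᵢ`. The combination is found as a dual solution of a linear
program. It is kept short by symmetry: the entropies are first summed over a group of symmetries of
the access structure, so that symmetric inequalities coincide. Copies of the permuted families may
be made separately, because entropy functions are only used through linear identities and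
inequalities, which sums inherit (`VariableFamily.exists_isSymmetrizedExtension`).

A random variable on a finite probability space enters through its partition into level sets.
`relEntropy_inf_add_le` is the submodularity of the entropy of partitions, proved from
`log x ≤ x - 1`, and `relEntropy_copyMass` is the conditional independence of the copies; the larger
space consists of pairs of points with the law `copyMass`. The identity between linear forms is
checked by evaluation in the kernel: `Certificate.form` rewrites each entropy by the available
equations, and `LinForm.eval_eq_zero_of_cancels` reduces the vanishing of all coefficients to that of
a single integer, the value at the powers of a large number. `Certificate.bound_le_of_isValid` is the
resulting inequality, and `Certificate.le_informationRatio` its form for access structures.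
-/

/-! ### Entropy of an equivalence relation on a finite weighted set -/

namespace SecretSharing

open scoped Classical in
/-- The total weight of the class of `a` under the equivalence relation `r`. -/
noncomputable def classMass {Ω : Type*} [Fintype Ω] (p : Ω → ℝ) (r : Setoid Ω) (a : Ω) : ℝ :=
  ∑ b, if r a b then p b else 0

/-- The entropy of the partition of `Ω` into the classes of `r`, written as the expectation of
`-log` of the weight of the class of a random point. This form needs no name for the classes. -/
noncomputable def relEntropy {Ω : Type*} [Fintype Ω] (p : Ω → ℝ) (r : Setoid Ω) : ℝ :=
  -∑ a, p a * Real.log (classMass p r a)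

lemma inf_rel {Ω : Type*} (r s : Setoid Ω) (a b : Ω) : (r ⊓ s) a b ↔ r a b ∧ s a b := Iff.rfl

section RelEntropy

variable {Ω : Type*} [Fintype Ω] {p : Ω → ℝ}

lemma classMass_congr {r : Setoid Ω} {a b : Ω} (h : r a b) :
    classMass p r a = classMass p r b := by
  classical
  unfold classMass
  refine Finset.sum_congr rfl fun c _ => ?_
  exact if_congr ⟨fun hc => r.trans (r.symm h) hc, fun hc => r.trans h hc⟩ rfl rfl

lemma classMass_nonneg (hp : ∀ a, 0 ≤ p a) (r : Setoid Ω) (a : Ω) : 0 ≤ classMass p r a := by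
  refine Finset.sum_nonneg fun b _ => ?_
  split_ifs
  exacts [hp b, le_rfl]

lemma classMass_pos (hp : ∀ a, 0 ≤ p a) (r : Setoid Ω) {a : Ω} (ha : p a ≠ 0) :
    0 < classMass p r a := by
  classical
  have h : p a ≤ classMass p r a := by
    have := Finset.single_le_sum (f := fun b => if r a b then p b else 0)
      (fun b _ => by split_ifs; exacts [hp b, le_rfl]) (Finset.mem_univ a)
    simpa [classMass, r.refl a] using this
  exact lt_of_lt_of_le (lt_of_le_of_ne (hp a) (Ne.symm ha)) h

/-- Within one class, the weights relative to the weight of the class add up to at most one. -/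
lemma sum_div_classMass_le_one (hp : ∀ a, 0 ≤ p a) (r : Setoid Ω) (P : Ω → Prop)
    [DecidablePred P] (hP : ∀ a b, P a → P b → r a b) :
    ∑ c, (if P c then p c / classMass p r c else 0) ≤ 1 := by
  classical
  by_cases h : ∃ c, P c ∧ p c ≠ 0
  · obtain ⟨c, hc, hpc⟩ := h
    have hpos := classMass_pos hp r hpc
    calc ∑ d, (if P d then p d / classMass p r d else 0)
        ≤ ∑ d, (if r c d then p d else 0) / classMass p r c := by
          refine Finset.sum_le_sum fun d _ => ?_
          by_cases hd : P d
          · have := hP c d hc hd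
            simp [hd, this, classMass_congr this]
          · simp only [hd, if_false]
            refine div_nonneg ?_ hpos.le
            split_ifs
            exacts [hp d, le_rfl]
      _ = 1 := by
          rw [← Finset.sum_div]
          exact div_self hpos.ne'
  · push Not at h
    refine (Finset.sum_nonpos fun d _ => ?_).trans zero_le_one
    split_ifs with hd
    · simp [h d hd]
    · exact le_rfl

/-- Submodularity of the entropy. The relation `t` stands for any function of both variables, which
is more general than their common information. -/
theorem relEntropy_inf_add_le (hp : ∀ a, 0 ≤ p a) {r s t : Setoid Ω} (hr : r ≤ t) (hs : s ≤ t) :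
    relEntropy p (r ⊓ s) + relEntropy p t ≤ relEntropy p r + relEntropy p s := by
  classical
  set mr := classMass p r
  set ms := classMass p s
  set mt := classMass p t
  set mi := classMass p (r ⊓ s)
  -- The ratio of the product of the two conditional laws given `t` to the joint law.
  let x : Ω → ℝ := fun c => mr c * ms c / (mi c * mt c)
  have key : ∀ c, p c * (1 - x c) ≤
      p c * (Real.log (mi c) + Real.log (mt c) - Real.log (mr c) - Real.log (ms c)) := by
    intro c
    by_cases hc : p c = 0
    · simp [hc]
    have h1 : 0 < mr c := classMass_pos hp r hc
    have h2 : 0 < ms c := classMass_pos hp s hc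
    have h3 : 0 < mt c := classMass_pos hp t hc
    have h4 : 0 < mi c := classMass_pos hp (r ⊓ s) hc
    refine mul_le_mul_of_nonneg_left ?_ (hp c)
    have hx : 0 < x c := by positivity
    have hlog : Real.log (x c) =
        Real.log (mr c) + Real.log (ms c) - (Real.log (mi c) + Real.log (mt c)) := by
      simp only [x]
      rw [Real.log_div (by positivity) (by positivity), Real.log_mul h1.ne' h2.ne',
        Real.log_mul h4.ne' h3.ne']
    have := Real.log_le_sub_one_of_pos hx
    linarith
  have hx_sum : ∑ c, p c * x c ≤ ∑ a, p a := by
    have expand : ∀ c, p c * x c = ∑ a, ∑ b,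
        (if r c a ∧ s c b then p c / mi c else 0) * (p a * p b / mt c) := by
      intro c
      have : mr c * ms c = ∑ a, ∑ b, (if r c a then p a else 0) * (if s c b then p b else 0) := by
        simp only [mr, ms, classMass]
        rw [Finset.sum_mul_sum]
      have hx : p c * x c = mr c * ms c * (p c / mi c / mt c) := by
        simp only [x, div_eq_mul_inv, mul_inv]
        ring
      rw [hx, this, Finset.sum_mul]
      refine Finset.sum_congr rfl fun a _ => ?_
      rw [Finset.sum_mul]
      refine Finset.sum_congr rfl fun b _ => ?_
      by_cases h1 : r c a <;> by_cases h2 : s c b <;> simp [h1, h2]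
      ring
    calc ∑ c, p c * x c
        = ∑ a, ∑ b, ∑ c, (if r c a ∧ s c b then p c / mi c else 0) * (p a * p b / mt c) := by
          simp only [expand]
          rw [Finset.sum_comm]
          exact Finset.sum_congr rfl fun a _ => Finset.sum_comm
      _ ≤ ∑ a, ∑ b, (if t a b then p b else 0) * (p a / mt a) := by
          refine Finset.sum_le_sum fun a _ => Finset.sum_le_sum fun b _ => ?_
          by_cases hab : t a b
          · have hle := sum_div_classMass_le_one hp (r ⊓ s) (fun c => r c a ∧ s c b)
              (fun c d hc hd => ⟨r.trans hc.1 (r.symm hd.1), s.trans hc.2 (s.symm hd.2)⟩)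
            calc ∑ c, (if r c a ∧ s c b then p c / mi c else 0) * (p a * p b / mt c)
                = (∑ c, if r c a ∧ s c b then p c / mi c else 0) * (p a * p b / mt a) := by
                  rw [Finset.sum_mul]
                  refine Finset.sum_congr rfl fun c _ => ?_
                  by_cases hc : r c a ∧ s c b
                  · rw [show mt c = mt a from classMass_congr (hr hc.1)]
                  · simp [hc]
              _ ≤ 1 * (p a * p b / mt a) := by
                  refine mul_le_mul_of_nonneg_right hle ?_
                  exact div_nonneg (mul_nonneg (hp a) (hp b)) (classMass_nonneg hp t a)
              _ = (if t a b then p b else 0) * (p a / mt a) := by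
                  rw [if_pos hab]
                  ring
          · refine (Finset.sum_nonpos fun c _ => ?_).trans (by simp [hab])
            have : ¬ (r c a ∧ s c b) := fun hc => hab (t.trans (t.symm (hr hc.1)) (hs hc.2))
            simp [this]
      _ = ∑ a, mt a * (p a / mt a) := by
          refine Finset.sum_congr rfl fun a _ => ?_
          rw [← Finset.sum_mul]
          rfl
      _ ≤ ∑ a, p a := by
          refine Finset.sum_le_sum fun a _ => ?_
          by_cases ha : p a = 0
          · simp [ha]
          · rw [mul_div_cancel₀ _ (classMass_pos hp t ha).ne']
  have hsum := Finset.sum_le_sum fun c (_ : c ∈ Finset.univ) => key c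
  simp only [mul_sub, mul_add, mul_one, Finset.sum_sub_distrib, Finset.sum_add_distrib] at hsum
  simp only [relEntropy]
  linarith

/-- The entropy only depends on the relation between points of positive weight. -/
lemma relEntropy_congr {r s : Setoid Ω} (h : ∀ a b, p a ≠ 0 → p b ≠ 0 → (r a b ↔ s a b)) :
    relEntropy p r = relEntropy p s := by
  classical
  unfold relEntropy
  congr 1
  refine Finset.sum_congr rfl fun a _ => ?_
  by_cases ha : p a = 0
  · simp [ha]
  congr 2
  refine Finset.sum_congr rfl fun b _ => ?_
  by_cases hb : p b = 0
  · simp [hb]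
  · exact if_congr (h a b ha hb) rfl rfl

/-- A sum over a weighted set may be computed after a map that carries the weights over. -/
lemma sum_mul_comp_eq {Ω' : Type*} [Fintype Ω'] [DecidableEq Ω] {q : Ω' → ℝ} {π : Ω' → Ω}
    (hπ : ∀ a, ∑ x, (if π x = a then q x else 0) = p a) (f : Ω → ℝ) :
    ∑ x, q x * f (π x) = ∑ a, p a * f a := by
  simp only [← hπ, Finset.sum_mul]
  rw [Finset.sum_comm]
  simp

lemma relEntropy_comap {Ω' : Type*} [Fintype Ω'] [DecidableEq Ω] {q : Ω' → ℝ} {π : Ω' → Ω}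
    (hπ : ∀ a, ∑ x, (if π x = a then q x else 0) = p a) (r : Setoid Ω) :
    relEntropy q (r.comap π) = relEntropy p r := by
  classical
  have hm : ∀ x, classMass q (r.comap π) x = classMass p r (π x) := by
    intro x
    have := sum_mul_comp_eq hπ (fun b => if r (π x) b then 1 else 0)
    simpa [classMass, Setoid.comap_rel] using this
  unfold relEntropy
  simp only [hm]
  rw [sum_mul_comp_eq hπ (fun a => Real.log (classMass p r a))]

/-- The law of a pair of points with law `p` each that lie in the same class of `x` and are
independent given this class. -/
noncomputable def copyMass (p : Ω → ℝ) (x : Setoid Ω) (c : Ω × Ω) : ℝ :=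
  open scoped Classical in if x c.1 c.2 then p c.1 * p c.2 / classMass p x c.1 else 0

variable {x : Setoid Ω}

lemma copyMass_nonneg (hp : ∀ a, 0 ≤ p a) (c : Ω × Ω) : 0 ≤ copyMass p x c := by
  unfold copyMass
  split_ifs
  exacts [div_nonneg (mul_nonneg (hp _) (hp _)) (classMass_nonneg hp _ _), le_rfl]

lemma copyMass_swap (a b : Ω) : copyMass p x (a, b) = copyMass p x (b, a) := by
  unfold copyMass
  by_cases h : x a b
  · simp [h, x.symm h, classMass_congr h, mul_comm]
  · have h' : ¬ x b a := fun h' => h (x.symm h')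
    simp [h, h']

lemma rel_of_copyMass_ne_zero {c : Ω × Ω} (h : copyMass p x c ≠ 0) : x c.1 c.2 := by
  by_contra hc
  exact h (by simp [copyMass, hc])

lemma sum_copyMass (hp : ∀ a, 0 ≤ p a) (a : Ω) : ∑ b, copyMass p x (a, b) = p a := by
  classical
  by_cases ha : p a = 0
  · simp [copyMass, ha]
  have : ∀ b, copyMass p x (a, b) = (if x a b then p b else 0) * (p a / classMass p x a) := by
    intro b
    unfold copyMass
    split_ifs
    · ring
    · simp
  simp only [this]
  rw [← Finset.sum_mul]
  exact mul_div_cancel₀ _ (classMass_pos hp x ha).ne'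

lemma copyMass_fst [DecidableEq Ω] (hp : ∀ a, 0 ≤ p a) (a : Ω) :
    ∑ c : Ω × Ω, (if c.1 = a then copyMass p x c else 0) = p a := by
  rw [Fintype.sum_prod_type, Finset.sum_comm]
  simp [sum_copyMass hp]

lemma copyMass_snd [DecidableEq Ω] (hp : ∀ a, 0 ≤ p a) (a : Ω) :
    ∑ c : Ω × Ω, (if c.2 = a then copyMass p x c else 0) = p a := by
  rw [Fintype.sum_prod_type]
  simp only [Finset.sum_ite_eq', Finset.mem_univ, if_true]
  simp only [copyMass_swap _ a, sum_copyMass hp]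

/-- Given `x`, the two points of the pair are independent: a variable of the first point that
determines `x` and a variable of the second point satisfy the chain rule of conditional
independence. -/
theorem relEntropy_copyMass (hp : ∀ a, 0 ≤ p a) {r s : Setoid Ω} (hr : r ≤ x) :
    relEntropy (copyMass p x) (r.comap Prod.fst ⊓ s.comap Prod.snd) =
      relEntropy p r + relEntropy p (x ⊓ s) - relEntropy p x := by
  classical
  have hm : ∀ c : Ω × Ω, x c.1 c.2 →
      classMass (copyMass p x) (r.comap Prod.fst ⊓ s.comap Prod.snd) c =
        classMass p r c.1 * classMass p (x ⊓ s) c.2 / classMass p x c.1 := by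
    rintro ⟨a, b⟩ hab
    dsimp only at hab ⊢
    unfold classMass
    rw [Fintype.sum_prod_type, Finset.sum_mul_sum, Finset.sum_div]
    refine Finset.sum_congr rfl fun a' _ => ?_
    rw [Finset.sum_div]
    refine Finset.sum_congr rfl fun b' _ => ?_
    by_cases h1 : r a a'
    · have hx : x a a' := hr h1
      have hiff : x a' b' ↔ x b b' :=
        ⟨fun h => x.trans (x.symm hab) (x.trans hx h),
          fun h => x.trans (x.symm hx) (x.trans hab h)⟩
      have hcl := classMass_congr (p := p) hx
      unfold classMass at hcl
      by_cases h2 : s b b' <;> by_cases h3 : x b b'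
      · have h4 : (x ⊓ s) b b' := ⟨h3, h2⟩
        simp [copyMass, classMass, inf_rel, Setoid.comap_rel, h1, h2, h3, h4, hiff, hcl]
      all_goals
        have h4 : ¬ (x ⊓ s) b b' := fun h => by first | exact h3 h.1 | exact h2 h.2
        simp [copyMass, inf_rel, Setoid.comap_rel, h2, h3, h4, hiff]
    · simp [inf_rel, Setoid.comap_rel, h1]
  have hlog : ∀ c : Ω × Ω,
      copyMass p x c * Real.log (classMass (copyMass p x)
        (r.comap Prod.fst ⊓ s.comap Prod.snd) c) =
      copyMass p x c * Real.log (classMass p r c.1) +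
        copyMass p x c * Real.log (classMass p (x ⊓ s) c.2) -
        copyMass p x c * Real.log (classMass p x c.1) := by
    intro c
    by_cases hc : copyMass p x c = 0
    · simp [hc]
    have hx := rel_of_copyMass_ne_zero hc
    have h1 : p c.1 ≠ 0 := fun h => hc (by simp [copyMass, h])
    have h2 : p c.2 ≠ 0 := fun h => hc (by simp [copyMass, h])
    have p1 := (classMass_pos hp r h1).ne'
    have p2 := (classMass_pos hp (x ⊓ s) h2).ne'
    have p3 := (classMass_pos hp x h1).ne'
    rw [hm c hx, Real.log_div (mul_ne_zero p1 p2) p3, Real.log_mul p1 p2]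
    ring
  unfold relEntropy
  simp only [hlog, Finset.sum_add_distrib, Finset.sum_sub_distrib]
  rw [sum_mul_comp_eq (copyMass_fst hp) (fun a => Real.log (classMass p r a)),
    sum_mul_comp_eq (copyMass_snd hp) (fun a => Real.log (classMass p (x ⊓ s) a)),
    sum_mul_comp_eq (copyMass_fst hp) (fun a => Real.log (classMass p x a))]
  ring

end RelEntropy

/-- The Shannon entropy of a random variable is the entropy of the relation `f a = f b`. -/
lemma entropy_map {Ω β : Type*} [Fintype Ω] [Fintype β] (P : PMF Ω) (f : Ω → β) :
    entropy (P.map f) = relEntropy (fun a => (P a).toReal) (Setoid.ker f) := by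
  classical
  have hmap : ∀ y, ((P.map f) y).toReal = ∑ a, if f a = y then (P a).toReal else 0 := by
    intro y
    rw [PMF.map_apply, tsum_fintype, ENNReal.toReal_sum]
    · refine Finset.sum_congr rfl fun a _ => ?_
      by_cases h : f a = y
      · simp [h]
      · simp [h, Ne.symm h]
    · intro a _
      split_ifs
      exacts [P.apply_ne_top a, ENNReal.zero_ne_top]
  have hcl : ∀ a, classMass (fun a => (P a).toReal) (Setoid.ker f) a = ((P.map f) (f a)).toReal := by
    intro a
    rw [hmap]
    refine Finset.sum_congr rfl fun b _ => ?_
    simp only [Setoid.ker_def, eq_comm]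
  unfold entropy relEntropy
  simp only [hcl]
  rw [sum_mul_comp_eq (fun y => (hmap y).symm) (fun y => Real.log ((P.map f) y).toReal),
    ← Finset.sum_neg_distrib]
  simp [Real.negMulLog]

end SecretSharing

/-! ### Sets of random variables as bit masks -/

namespace SecretSharing

/-- The union of the sets `l[i]` over the elements `i` of the set `S`. Sets of random variables are
natural numbers here, the set `S` having the element `i` when the `i`-th bit of `S` is one. -/
def unionOver : List ℕ → ℕ → ℕ
  | [], _ => 0
  | b :: l, S => (if S % 2 = 1 then b else 0) ||| unionOver l (S / 2)

lemma and_eq_left_iff {S T : ℕ} : S &&& T = S ↔ ∀ i, S.testBit i → T.testBit i := by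
  constructor
  · intro h i hi
    rw [← h, Nat.testBit_and, Bool.and_eq_true] at hi
    exact hi.2
  · intro h
    refine Nat.eq_of_testBit_eq fun i => ?_
    rw [Nat.testBit_and]
    have := h i
    cases hS : S.testBit i <;> simp_all

lemma testBit_unionOver (l : List ℕ) (S i : ℕ) :
    (unionOver l S).testBit i ↔ ∃ j, S.testBit j ∧ (l.getD j 0).testBit i := by
  induction l generalizing S with
  | nil => simp [unionOver]
  | cons b l ih =>
    rw [unionOver, Nat.testBit_or, Bool.or_eq_true, ih]
    constructor
    · rintro (h | ⟨j, hj, hi⟩)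
      · refine ⟨0, ?_⟩
        by_cases hS : S % 2 = 1
        · simp_all [Nat.testBit_zero]
        · simp [hS] at h
      · exact ⟨j + 1, by rwa [Nat.testBit_succ], by simpa using hi⟩
    · rintro ⟨j, hj, hi⟩
      cases j with
      | zero =>
        left
        simp_all [Nat.testBit_zero]
      | succ j => exact Or.inr ⟨j, by rwa [← Nat.testBit_succ], by simpa using hi⟩

lemma unionOver_zero (l : List ℕ) : unionOver l 0 = 0 := by
  refine Nat.eq_of_testBit_eq fun i => ?_
  have := testBit_unionOver l 0 i
  simp_all

lemma unionOver_lt {l : List ℕ} {n : ℕ} (h : ∀ b ∈ l, b < 2 ^ n) (S : ℕ) :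
    unionOver l S < 2 ^ n := by
  induction l generalizing S with
  | nil => simp [unionOver]
  | cons b l ih =>
    simp only [List.mem_cons, forall_eq_or_imp] at h
    refine Nat.or_lt_two_pow ?_ (ih h.2 _)
    split_ifs
    exacts [h.1, by positivity]

/-! ### Families of random variables and copies -/

/-- A sequence of random variables on a finite probability space. A random variable enters only
through the relation that it takes the same value at two points of the space. -/
structure VariableFamily where
  Ω : Type
  fintype : Fintype Ω
  p : Ω → ℝ
  p_nonneg : ∀ a, 0 ≤ p a
  r : ℕ → Setoid Ω

namespace VariableFamily

attribute [instance] VariableFamily.fintype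

/-- The relation that all the variables in the set `S` take the same values. -/
def rel (M : VariableFamily) (S : ℕ) : Setoid M.Ω where
  r a b := ∀ i, S.testBit i → M.r i a b
  iseqv := ⟨fun a i _ => (M.r i).refl a, fun h i hi => (M.r i).symm (h i hi),
    fun h h' i hi => (M.r i).trans (h i hi) (h' i hi)⟩

/-- The joint entropy of the variables in the set `S`. -/
noncomputable def h (M : VariableFamily) (S : ℕ) : ℝ := relEntropy M.p (M.rel S)

variable (M : VariableFamily)

lemma rel_iff {S : ℕ} {a b : M.Ω} : M.rel S a b ↔ ∀ i, S.testBit i → M.r i a b := Iff.rfl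

lemma rel_or_iff {S T : ℕ} {a b : M.Ω} : M.rel (S ||| T) a b ↔ M.rel S a b ∧ M.rel T a b := by
  simp only [rel_iff, Nat.testBit_or, Bool.or_eq_true, or_imp, forall_and]

lemma rel_or (S T : ℕ) : M.rel (S ||| T) = M.rel S ⊓ M.rel T :=
  Setoid.ext fun _ _ => M.rel_or_iff

lemma rel_anti {S T : ℕ} (h : S &&& T = S) : M.rel T ≤ M.rel S :=
  fun _ _ hab i hi => hab i (and_eq_left_iff.1 h i hi)

lemma rel_unionOver_iff {l : List ℕ} {S : ℕ} {a b : M.Ω} :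
    M.rel (unionOver l S) a b ↔ ∀ j, S.testBit j → M.rel (l.getD j 0) a b := by
  simp only [rel_iff, testBit_unionOver]
  exact ⟨fun h j hj i hi => h i ⟨j, hj, hi⟩, fun h i ⟨j, hj, hi⟩ => h j hj i hi⟩

/-- Conditional mutual information is nonnegative. For `A = B` this says that conditional entropy
is nonnegative. -/
theorem condMutualInfo_nonneg (A B C : ℕ) :
    0 ≤ M.h (A ||| C) + M.h (B ||| C) - M.h (A ||| B ||| C) - M.h C := by
  have h1 : M.rel (A ||| B ||| C) = M.rel (A ||| C) ⊓ M.rel (B ||| C) := by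
    rw [← rel_or]
    congr 1
    refine Nat.eq_of_testBit_eq fun i => ?_
    simp only [Nat.testBit_or]
    cases A.testBit i <;> cases B.testBit i <;> cases C.testBit i <;> rfl
  have hle : ∀ D, M.rel (D ||| C) ≤ M.rel C := fun D => by
    rw [rel_or]
    exact inf_le_right
  have := relEntropy_inf_add_le M.p_nonneg (hle A) (hle B)
  rw [← h1] at this
  unfold h
  linarith

/-- The family in which the `i`-th variable is the tuple of the old variables in the set `l[i]`. -/
def regroup (l : List ℕ) : VariableFamily where
  Ω := M.Ω
  fintype := M.fintype
  p := M.p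
  p_nonneg := M.p_nonneg
  r i := M.rel (l.getD i 0)

lemma h_regroup (l : List ℕ) (S : ℕ) : (M.regroup l).h S = M.h (unionOver l S) := by
  have : (M.regroup l).rel S = M.rel (unionOver l S) :=
    Setoid.ext fun a b => (M.rel_unionOver_iff (l := l) (S := S) (a := a) (b := b)).symm
  unfold h
  rw [this]
  rfl

/-- The family with the variables `0, …, n - 1` of `M` and with copies `n, n + 1, …` of the tuples
`Ys[0], Ys[1], …` of variables. Jointly with the variables in `X` the copies have the law of the
originals, and given these variables they are independent of the variables `0, …, n - 1`. -/
noncomputable def copy (n X : ℕ) (Ys : List ℕ) : VariableFamily where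
  Ω := M.Ω × M.Ω
  fintype := inferInstance
  p := copyMass M.p (M.rel X)
  p_nonneg := copyMass_nonneg M.p_nonneg
  r i := if i < n then (M.r i).comap Prod.fst else (M.rel (Ys.getD (i - n) 0)).comap Prod.snd

variable {n X : ℕ} {Ys : List ℕ}

lemma copy_r_iff (i : ℕ) (a b : M.Ω × M.Ω) : (M.copy n X Ys).r i a b ↔
    if i < n then M.r i a.1 b.1 else M.rel (Ys.getD (i - n) 0) a.2 b.2 := by
  change (if i < n then (M.r i).comap Prod.fst
    else (M.rel (Ys.getD (i - n) 0)).comap Prod.snd : Setoid (M.Ω × M.Ω)) a b ↔ _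
  by_cases hin : i < n
  · rw [if_pos hin, if_pos hin]
    rfl
  · rw [if_neg hin, if_neg hin]
    rfl

lemma rel_copy (S : ℕ) : (M.copy n X Ys).rel S =
    (M.rel (S % 2 ^ n)).comap Prod.fst ⊓ (M.rel (unionOver Ys (S / 2 ^ n))).comap Prod.snd := by
  refine Setoid.ext fun a b => ?_
  change (∀ i, S.testBit i → (M.copy n X Ys).r i a b) ↔
    (∀ i, (S % 2 ^ n).testBit i → M.r i a.1 b.1) ∧ M.rel (unionOver Ys (S / 2 ^ n)) a.2 b.2
  rw [rel_unionOver_iff]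
  constructor
  · intro h
    refine ⟨fun i hi => ?_, fun j hj => ?_⟩
    · rw [Nat.testBit_mod_two_pow, Bool.and_eq_true, decide_eq_true_eq] at hi
      have := (M.copy_r_iff i a b).1 (h i hi.2)
      rwa [if_pos hi.1] at this
    · rw [Nat.testBit_div_two_pow] at hj
      have := (M.copy_r_iff _ a b).1 (h _ hj)
      rwa [if_neg (by omega), Nat.add_sub_cancel] at this
  · rintro ⟨h1, h2⟩ i hi
    refine (M.copy_r_iff i a b).2 ?_
    split_ifs with hin
    · exact h1 i (by simp [Nat.testBit_mod_two_pow, hin, hi])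
    · exact h2 (i - n) (by rwa [Nat.testBit_div_two_pow, Nat.sub_add_cancel (by omega)])

lemma h_copy_of_lt {S : ℕ} (hS : S < 2 ^ n) : (M.copy n X Ys).h S = M.h S := by
  classical
  have : (M.copy n X Ys).rel S = (M.rel S).comap Prod.fst := by
    rw [rel_copy, Nat.mod_eq_of_lt hS, Nat.div_eq_of_lt hS, unionOver_zero]
    refine Setoid.ext fun a b => ?_
    change M.rel S a.1 b.1 ∧ M.rel 0 a.2 b.2 ↔ M.rel S a.1 b.1
    exact and_iff_left fun i hi => by simp at hi
  unfold h
  rw [this]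
  exact relEntropy_comap (copyMass_fst M.p_nonneg) _

/-- Together with variables in `X` the copies have the entropy of the originals. -/
lemma h_copy_of_subset {S : ℕ} (hS : S % 2 ^ n &&& X = S % 2 ^ n) :
    (M.copy n X Ys).h S = M.h (S % 2 ^ n ||| unionOver Ys (S / 2 ^ n)) := by
  classical
  have : (M.copy n X Ys).h S = relEntropy (copyMass M.p (M.rel X))
      ((M.rel (S % 2 ^ n ||| unionOver Ys (S / 2 ^ n))).comap Prod.snd) := by
    unfold h
    rw [rel_copy]
    refine relEntropy_congr fun a b ha hb => ?_
    change M.rel _ a.1 b.1 ∧ M.rel _ a.2 b.2 ↔ M.rel (_ ||| _) a.2 b.2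
    rw [rel_or_iff]
    refine and_congr_left fun _ => ?_
    have ha' := M.rel_anti hS (rel_of_copyMass_ne_zero ha)
    have hb' := M.rel_anti hS (rel_of_copyMass_ne_zero hb)
    exact ⟨fun h => Setoid.trans' _ (Setoid.symm' _ ha') (Setoid.trans' _ h hb'),
      fun h => Setoid.trans' _ ha' (Setoid.trans' _ h (Setoid.symm' _ hb'))⟩
  rw [this]
  exact relEntropy_comap (copyMass_snd M.p_nonneg) _

/-- Given the variables in `X`, the copies are independent of the old variables. -/
lemma h_copy_of_superset {S : ℕ} (hS : X &&& S % 2 ^ n = X) :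
    (M.copy n X Ys).h S =
      M.h (S % 2 ^ n) + M.h (X ||| unionOver Ys (S / 2 ^ n)) - M.h X := by
  unfold h
  rw [rel_copy, rel_or]
  exact relEntropy_copyMass M.p_nonneg (M.rel_anti hS)

end VariableFamily

/-! ### Iterated copies -/

/-- The data of a copy step: there are `n` old variables, and the tuples `Ys` are copied
over `X`. -/
structure CopyStep where
  n : ℕ
  X : ℕ
  Ys : List ℕ

namespace CopyStep

/-- The entropy function `g` satisfies the identities of the copy step `s`. -/
def HoldsFor (s : CopyStep) (g : ℕ → ℝ) : Prop :=
  ∀ S < 2 ^ (s.n + s.Ys.length),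
    (S % 2 ^ s.n &&& s.X = S % 2 ^ s.n → g S = g (S % 2 ^ s.n ||| unionOver s.Ys (S / 2 ^ s.n))) ∧
    (s.X &&& S % 2 ^ s.n = s.X →
      g S = g (S % 2 ^ s.n) + g (s.X ||| unionOver s.Ys (S / 2 ^ s.n)) - g s.X)

/-- The steps in the list, the last step first, start from eight variables, end with at most `N`
variables, and only use variables that exist at the time. -/
def WellFormed : List CopyStep → ℕ → Bool
  | [], N => decide (8 ≤ N)
  | s :: l, N => decide (s.n + s.Ys.length ≤ N) && decide (s.X < 2 ^ s.n) &&
      s.Ys.all (fun Y => decide (Y < 2 ^ s.n)) && WellFormed l s.n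

end CopyStep

/-- The copies of a list of steps can be made one after the other. -/
lemma VariableFamily.exists_copies (M : VariableFamily) {l : List CopyStep} {N : ℕ}
    (hl : CopyStep.WellFormed l N) : ∃ M' : VariableFamily, ∀ g : ℕ → ℝ,
      (∀ S < 2 ^ N, g S = M'.h S) → (∀ S < 2 ^ 8, g S = M.h S) ∧ ∀ s ∈ l, s.HoldsFor g := by
  induction l generalizing N with
  | nil =>
    refine ⟨M, fun g hg => ⟨fun S hS => hg S (hS.trans_le ?_), by simp⟩⟩
    exact Nat.pow_le_pow_right (by norm_num) (by simpa [CopyStep.WellFormed] using hl)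
  | cons s l ih =>
    simp only [CopyStep.WellFormed, Bool.and_eq_true, decide_eq_true_eq, List.all_eq_true] at hl
    obtain ⟨⟨⟨hN, hX⟩, hY⟩, hl⟩ := hl
    obtain ⟨M', hM'⟩ := ih hl
    have hle : 2 ^ s.n ≤ 2 ^ (s.n + s.Ys.length) :=
      Nat.pow_le_pow_right (by norm_num) (Nat.le_add_right _ _)
    have hle' : 2 ^ (s.n + s.Ys.length) ≤ 2 ^ N := Nat.pow_le_pow_right (by norm_num) hN
    refine ⟨M'.copy s.n s.X s.Ys, fun g hg => ?_⟩
    have hg' : ∀ S < 2 ^ s.n, g S = M'.h S := fun S hS => by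
      rw [hg S (hS.trans_le (hle.trans hle')), M'.h_copy_of_lt hS]
    obtain ⟨h1, h2⟩ := hM' g hg'
    refine ⟨h1, fun t ht => ?_⟩
    rcases List.mem_cons.1 ht with rfl | ht
    · intro S hS
      have hmod : S % 2 ^ t.n < 2 ^ t.n := Nat.mod_lt _ (by positivity)
      have hU := unionOver_lt hY (S / 2 ^ t.n)
      rw [hg S (hS.trans_le hle')]
      refine ⟨fun h => ?_, fun h => ?_⟩
      · rw [M'.h_copy_of_subset h, hg' _ (Nat.or_lt_two_pow hmod hU)]
      · rw [M'.h_copy_of_superset h, hg' _ hmod, hg' _ (Nat.or_lt_two_pow hX hU), hg' _ hX]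
    · exact h2 t ht

/-- `g` is a sum of entropy functions of families which extend the regroupings by `σ ∈ G` of a
family with the entropy function `h` by copies. If `G` is a group of permutations of the variables,
then `g` restricts to a multiple of the average of `h` over `G`. -/
structure IsSymmetrizedExtension (h : ℕ → ℝ) (G : List (List ℕ)) (l : List CopyStep)
    (g : ℕ → ℝ) : Prop where
  condMutualInfo_nonneg : ∀ A B C, 0 ≤ g (A ||| C) + g (B ||| C) - g (A ||| B ||| C) - g C
  eq_sum : ∀ S < 2 ^ 8, g S = (G.map fun σ => h (unionOver σ S)).sum
  holdsFor : ∀ s ∈ l, s.HoldsFor g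

theorem VariableFamily.exists_isSymmetrizedExtension (M : VariableFamily) (G : List (List ℕ))
    {l : List CopyStep} {N : ℕ} (hl : CopyStep.WellFormed l N) :
    ∃ g, IsSymmetrizedExtension M.h G l g := by
  induction G with
  | nil => exact ⟨0, by simp, by simp, fun s _ S _ => by simp⟩
  | cons σ G ih =>
    obtain ⟨g, hg⟩ := ih
    obtain ⟨M', hM'⟩ := (M.regroup σ).exists_copies hl
    obtain ⟨h1, h2⟩ := hM' M'.h fun _ _ => rfl
    refine ⟨M'.h + g, fun A B C => ?_, fun S hS => ?_, fun s hs S hS => ?_⟩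
    · have := M'.condMutualInfo_nonneg A B C
      have := hg.condMutualInfo_nonneg A B C
      simp only [Pi.add_apply]
      linarith
    · simp only [Pi.add_apply, List.map_cons, List.sum_cons, h1 S hS, hg.eq_sum S hS, h_regroup]
    · obtain ⟨a1, a2⟩ := h2 s hs S hS
      obtain ⟨b1, b2⟩ := hg.holdsFor s hs S hS
      simp only [Pi.add_apply]
      refine ⟨fun h => ?_, fun h => ?_⟩
      · rw [a1 h, b1 h]
      · rw [a2 h, b2 h]
        ring

end SecretSharing

/-! ### Integral linear forms -/

namespace SecretSharing

/-- An integral linear form in unknowns that are numbered by `ℕ`, as a list of monomials. -/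
abbrev LinForm := List (ℤ × ℕ)

namespace LinForm

/-- The value of a linear form when the `n`-th unknown takes the value `v n`. -/
def eval (v : ℕ → ℝ) (L : LinForm) : ℝ := (L.map fun t => (t.1 : ℝ) * v t.2).sum

/-- The multiple of a linear form by a constant. -/
def smul (c : ℤ) (L : LinForm) : LinForm := L.map fun t => (c * t.1, t.2)

/-- The value of a linear form when the `n`-th unknown takes the value `2 ^ (b * n)`. The power is
written as a shift since this is what a kernel computes fastest. -/
def code (b : ℕ) (L : LinForm) : ℤ := L.foldr (fun t c => t.1 * (1 <<< (b * t.2) : ℕ) + c) 0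

/-- The sum of the absolute values of all coefficients. -/
def weight (L : LinForm) : ℕ := L.foldr (fun t c => t.1.natAbs + c) 0

/-- Whether all monomials cancel. If the coefficients are small, they can be read off from the
value at the powers of a large number, so that this value is zero only for the zero form. -/
def cancels (b : ℕ) (L : LinForm) : Bool := code b L == 0 && decide (weight L < 2 ^ b)

variable (v : ℕ → ℝ)

@[simp] lemma eval_nil : eval v [] = 0 := rfl

@[simp] lemma eval_cons (t : ℤ × ℕ) (L : LinForm) : eval v (t :: L) = t.1 * v t.2 + eval v L := by
  simp [eval]

@[simp] lemma eval_append (L L' : LinForm) : eval v (L ++ L') = eval v L + eval v L' := by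
  simp [eval]

@[simp] lemma eval_smul (c : ℤ) (L : LinForm) : eval v (smul c L) = c * eval v L := by
  induction L with
  | nil => simp [smul]
  | cons t L ih =>
    have : smul c (t :: L) = (c * t.1, t.2) :: smul c L := rfl
    rw [this, eval_cons, eval_cons, ih]
    push_cast
    ring

lemma eval_flatMap {α : Type*} (l : List α) (f : α → LinForm) :
    eval v (l.flatMap f) = (l.map fun a => eval v (f a)).sum := by
  induction l with
  | nil => simp
  | cons a l ih => simp [ih]

/-- The polynomial with the coefficients of a linear form. -/
noncomputable def toPolynomial (L : LinForm) : Polynomial ℤ :=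
  (L.map fun t => Polynomial.monomial t.2 t.1).sum

@[simp] lemma toPolynomial_nil : toPolynomial [] = 0 := rfl

@[simp] lemma toPolynomial_cons (t : ℤ × ℕ) (L : LinForm) :
    toPolynomial (t :: L) = Polynomial.monomial t.2 t.1 + toPolynomial L := by
  simp [toPolynomial]

lemma eval_toPolynomial (b : ℕ) (L : LinForm) : (toPolynomial L).eval (2 ^ b : ℤ) = code b L := by
  induction L with
  | nil => simp [code]
  | cons t L ih =>
    have : code b (t :: L) = t.1 * (1 <<< (b * t.2) : ℕ) + code b L := rfl
    rw [this, toPolynomial_cons, Polynomial.eval_add, ih, Polynomial.eval_monomial, Nat.shiftLeft_eq]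
    push_cast
    rw [one_mul, pow_mul]

lemma abs_coeff_toPolynomial_le (L : LinForm) (n : ℕ) : |(toPolynomial L).coeff n| ≤ weight L := by
  induction L with
  | nil => simp [weight]
  | cons t L ih =>
    have : weight (t :: L) = t.1.natAbs + weight L := rfl
    rw [this, toPolynomial_cons, Polynomial.coeff_add, Polynomial.coeff_monomial]
    push_cast
    refine (abs_add_le _ _).trans (add_le_add ?_ ih)
    split_ifs <;> simp

lemma eval_eq_sum_toPolynomial (L : LinForm) :
    eval v L = (toPolynomial L).sum fun n a => (a : ℝ) * v n := by
  induction L with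
  | nil => simp
  | cons t L ih =>
    rw [eval_cons, ih, toPolynomial_cons, Polynomial.sum_add_index _ _ _ (by simp)
      (by intros; push_cast; ring), Polynomial.sum_monomial_index _ _ (by simp)]

/-- A polynomial with small coefficients has no zero at a large number. -/
lemma _root_.Polynomial.eq_zero_of_eval_eq_zero_of_abs_coeff_lt {p : Polynomial ℤ} {B : ℤ}
    (hB : p.eval B = 0) (h : ∀ n, |p.coeff n| < B) : p = 0 := by
  have hpos : 0 < B := (abs_nonneg _).trans_lt (h 0)
  induction hd : p.natDegree using Nat.strong_induction_on generalizing p with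
  | _ d ih =>
    have hp := Polynomial.divX_mul_X_add p
    have h0 : p.coeff 0 = 0 := by
      refine Int.eq_zero_of_abs_lt_dvd (m := B) ?_ (h 0)
      rw [← hp] at hB
      simp only [Polynomial.eval_add, Polynomial.eval_mul, Polynomial.eval_X,
        Polynomial.eval_C] at hB
      exact ⟨-p.divX.eval B, by linarith⟩
    rw [h0, map_zero, add_zero] at hp
    have hroot : p.divX.eval B = 0 := by
      rw [← hp, Polynomial.eval_mul, Polynomial.eval_X] at hB
      exact (mul_eq_zero.1 hB).resolve_right hpos.ne'
    by_cases hdeg : p.natDegree = 0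
    · rw [Polynomial.eq_C_of_natDegree_eq_zero hdeg, h0, map_zero]
    · have := ih _ (by rw [Polynomial.natDegree_divX_eq_natDegree_tsub_one]; omega) hroot
        (fun n => by rw [Polynomial.coeff_divX]; exact h (n + 1)) rfl
      rw [← hp, this, zero_mul]

lemma eval_eq_zero_of_cancels {b : ℕ} {L : LinForm} (h : cancels b L) : eval v L = 0 := by
  simp only [cancels, Bool.and_eq_true, beq_iff_eq, decide_eq_true_eq] at h
  rw [eval_eq_sum_toPolynomial, Polynomial.eq_zero_of_eval_eq_zero_of_abs_coeff_lt
    (p := toPolynomial L) (B := 2 ^ b) (by rw [eval_toPolynomial, h.1])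
    (fun n => (abs_coeff_toPolynomial_le L n).trans_lt (by exact_mod_cast h.2))]
  simp

end LinForm

/-! ### Certificates for lower bounds -/

/-- The set whose elements are the hexadecimal digits of `n`; so `vars 0x123` is `{1, 2, 3}`. The
digit `F` stands for the secret, the variable `0`, since a number has no leading digit `0`. -/
def vars (n : ℕ) : ℕ := go 16 n
where
  /-- The set of the last `k` digits. -/
  go : ℕ → ℕ → ℕ
    | 0, _ => 0
    | k + 1, n => if n = 0 then 0 else 2 ^ (n % 16 % 15) ||| go k (n / 16)

/-- Whether the set `S` includes one of the sets in the list. -/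
def accepts (minimal : List ℕ) (S : ℕ) : Bool := minimal.any fun m => m &&& S == m

/-- `h` is the entropy function of a secret sharing scheme with the given minimal accepted sets;
the secret is the variable `0`. -/
structure IsSchemeEntropy (minimal : List ℕ) (h : ℕ → ℝ) : Prop where
  zero : h 0 = 0
  of_accepts : ∀ q, accepts minimal (2 * q) = true → h (2 * q + 1) = h (2 * q)
  of_not_accepts : ∀ q, accepts minimal (2 * q) = false → h (2 * q + 1) = h (2 * q) + h 1

/-- A certificate that the information ratio of an access structure is at least
`bound / ∑ weights of the shares`. It consists of the minimal accepted sets, of a list of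
symmetries (the images of the participants `1, …, 7`), of copy steps (the last one first), of
weights `(w, i)` of the shares, and of a list of weighted conditional mutual informations:
`(w, A, B, C)` stands for `w * I(A; B | C)`. All sets are written as for `vars`. -/
structure Certificate where
  minimalSets : List ℕ
  symmetries : List (List ℕ)
  copySteps : List (ℕ × ℕ × List ℕ)
  shares : List (ℕ × ℕ)
  inequalities : List (ℕ × ℕ × ℕ × ℕ)
  bound : ℕ

namespace Certificate

/-- An unknown of the linear forms is either the value of `h` (even numbers) or of `g`
(odd numbers) at a set. -/
noncomputable def unknown (h g : ℕ → ℝ) (n : ℕ) : ℝ := if n % 2 = 0 then h (n / 2) else g (n / 2)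

/-- The linear form for `h T`, with the secret eliminated from `T`. The unknown with number `2` is
the entropy `h 1` of the secret, and `T / 2` is zero when `T` contains no share. -/
def baseForm (minimal : List ℕ) (T : ℕ) : LinForm :=
  (if T / 2 = 0 then [] else [(1, 4 * (T / 2))]) ++
    if T % 2 = 1 ∧ accepts minimal (2 * (T / 2)) = false then [(1, 2)] else []

/-- The linear form for `g S`. The identities of the copy steps remove copied variables from `S`
where they apply. For a set of original variables the form is the sum of `h` over its images under
the symmetries. To any other set the secret is added if the set is accepted, so that equal entropies
get the same unknown. -/
def form (minimal : List ℕ) (G : List (List ℕ)) : List CopyStep → ℕ → LinForm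
  | [], S =>
    if S < 2 ^ 8 then G.flatMap fun σ => baseForm minimal (unionOver σ S)
    else [(1, 2 * (if accepts minimal (S % 2 ^ 8) then S ||| 1 else S) + 1)]
  | s :: l, S =>
    if S < 2 ^ s.n ∨ 2 ^ (s.n + s.Ys.length) ≤ S then form minimal G l S
    else if S % 2 ^ s.n &&& s.X = S % 2 ^ s.n then
      form minimal G l (S % 2 ^ s.n ||| unionOver s.Ys (S / 2 ^ s.n))
    else if s.X &&& S % 2 ^ s.n = s.X then
      form minimal G l (S % 2 ^ s.n) ++ form minimal G l (s.X ||| unionOver s.Ys (S / 2 ^ s.n)) ++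
        (form minimal G l s.X).smul (-1)
    else form minimal G l S

/-- The list `σ` of images maps shares to shares and the secret to itself, and it preserves the
accepted sets. -/
def isSymmetry (minimal σ : List ℕ) : Bool :=
  unionOver σ 1 == 1 && minimal.all (fun m => accepts minimal (unionOver σ m)) &&
    (List.range 7).all fun i => (List.range 7).any fun j => unionOver σ (2 ^ (i + 1)) == 2 ^ (j + 1)

variable (c : Certificate)

/-- The minimal accepted sets as bit masks. -/
def minimal : List ℕ := c.minimalSets.map vars

/-- The sum of the weights of the shares. -/
def totalWeight : ℕ := (c.shares.map Prod.fst).sum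

/-- The symmetries as lists of the images of the variables; the secret is fixed. -/
def group : List (List ℕ) := c.symmetries.map fun l => 1 :: l.map fun i => 2 ^ i

/-- The copy steps with their sets as bit masks. -/
def steps : List CopyStep := c.copySteps.map fun s => ⟨s.1, vars s.2.1, s.2.2.map vars⟩

/-- The linear form for `I(A; B | C)`. -/
def infoForm (A B C : ℕ) : LinForm :=
  form c.minimal c.group c.steps (A ||| C) ++ form c.minimal c.group c.steps (B ||| C) ++
    ((form c.minimal c.group c.steps (A ||| B ||| C)).smul (-1) ++
      (form c.minimal c.group c.steps C).smul (-1))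

/-- The sum of the weighted conditional mutual informations, minus the weighted entropies of the
shares, plus the bound times the entropy of the secret. These are entropies of the symmetrized
extension, in which the secret has its entropy `h 1` once for every symmetry. -/
def totalForm (c : Certificate) : LinForm :=
  (c.inequalities.flatMap fun t =>
      (c.infoForm (vars t.2.1) (vars t.2.2.1) (vars t.2.2.2)).smul (t.1 : ℤ)) ++
    ((c.shares.flatMap fun t => (form c.minimal c.group c.steps (2 ^ t.2)).smul (-(t.1 : ℤ))) ++
      [(((c.bound * c.symmetries.length : ℕ) : ℤ), 2)])

/-- The certificate is correct: the data fit together, and the linear form `totalForm` is zero.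
The number `16` of variables allowed and the exponent `20` for the size of the coefficients are only
chosen large enough for the use below. -/
def isValid : Bool :=
  decide (0 < c.symmetries.length) && CopyStep.WellFormed c.steps 16 &&
    c.group.all (isSymmetry c.minimal) &&
    c.shares.all (fun t => 1 ≤ t.2 && t.2 ≤ 7) && c.totalForm.cancels 20

variable {minimal : List ℕ} {G : List (List ℕ)} {l : List CopyStep} {h g : ℕ → ℝ}

lemma eval_baseForm (hh : IsSchemeEntropy minimal h) (T : ℕ) :
    (baseForm minimal T).eval (unknown h g) = h T := by
  have h1 : LinForm.eval (unknown h g) (if T / 2 = 0 then [] else [(1, 4 * (T / 2))]) =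
      h (2 * (T / 2)) := by
    split_ifs with h0
    · simp [h0, hh.zero]
    · have e1 : 4 * (T / 2) % 2 = 0 := by omega
      have e2 : 4 * (T / 2) / 2 = 2 * (T / 2) := by omega
      simp [unknown, e1, e2]
  rw [baseForm, LinForm.eval_append, h1]
  rcases Nat.mod_two_eq_zero_or_one T with hT | hT
  · have e : 2 * (T / 2) = T := by omega
    simp [hT, e]
  · have e : 2 * (T / 2) + 1 = T := by omega
    cases hacc : accepts minimal (2 * (T / 2))
    · have := hh.of_not_accepts _ hacc
      rw [e] at this
      simp [hT, unknown, this]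
    · have := hh.of_accepts _ hacc
      rw [e] at this
      simp [this]

lemma accepts_iff {S : ℕ} : accepts minimal S ↔ ∃ m ∈ minimal, m &&& S = m := by
  simp [accepts]

lemma accepts_mono {S T : ℕ} (hST : S &&& T = S) (hS : accepts minimal S) :
    accepts minimal T := by
  obtain ⟨m, hm, hmS⟩ := accepts_iff.1 hS
  refine accepts_iff.2 ⟨m, hm, ?_⟩
  rw [and_eq_left_iff] at *
  exact fun i hi => hST i (hmS i hi)

lemma unionOver_mono (σ : List ℕ) {S T : ℕ} (hST : S &&& T = S) :
    unionOver σ S &&& unionOver σ T = unionOver σ S := by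
  rw [and_eq_left_iff] at *
  intro i hi
  rw [testBit_unionOver] at *
  obtain ⟨j, hj, hi⟩ := hi
  exact ⟨j, hST j hj, hi⟩

lemma unionOver_or (σ : List ℕ) (S T : ℕ) :
    unionOver σ (S ||| T) = unionOver σ S ||| unionOver σ T := by
  refine Nat.eq_of_testBit_eq fun i => ?_
  rw [Bool.eq_iff_iff, Nat.testBit_or, Bool.or_eq_true]
  simp only [testBit_unionOver, Nat.testBit_or, Bool.or_eq_true, or_and_right, exists_or]

lemma accepts_unionOver {σ : List ℕ} (hσ : isSymmetry minimal σ) {S : ℕ}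
    (hS : accepts minimal S) : accepts minimal (unionOver σ S) := by
  simp only [isSymmetry, Bool.and_eq_true, List.all_eq_true] at hσ
  obtain ⟨m, hm, hmS⟩ := accepts_iff.1 hS
  exact accepts_mono (unionOver_mono σ hmS) (hσ.1.2 m hm)

lemma or_one_eq (T : ℕ) : T ||| 1 = 2 * (T / 2) + 1 := by
  have h1 : (T ||| 1) / 2 = T / 2 := by simp [Nat.or_div_two]
  have h2 : (T ||| 1) % 2 = 1 := by simp [Nat.or_mod_two_eq_one]
  omega

lemma _root_.SecretSharing.IsSchemeEntropy.or_one (hh : IsSchemeEntropy minimal h) {T : ℕ}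
    (hT : accepts minimal T) : h (T ||| 1) = h T := by
  rw [or_one_eq]
  rcases Nat.mod_two_eq_zero_or_one T with h2 | h2
  · have e : 2 * (T / 2) = T := by omega
    rw [hh.of_accepts _ (by rwa [e]), e]
  · rw [show 2 * (T / 2) + 1 = T by omega]

/-- In a symmetrized extension, too, the secret is determined by accepted sets. -/
lemma _root_.SecretSharing.IsSymmetrizedExtension.or_one (hg : IsSymmetrizedExtension h G l g)
    (hh : IsSchemeEntropy minimal h) (hG : ∀ σ ∈ G, isSymmetry minimal σ) {S : ℕ}
    (hS : accepts minimal (S % 2 ^ 8)) : g (S ||| 1) = g S := by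
  have hlt : S % 2 ^ 8 < 2 ^ 8 := Nat.mod_lt _ (by norm_num)
  have hJ : g (S % 2 ^ 8 ||| 1) = g (S % 2 ^ 8) := by
    rw [hg.eq_sum _ hlt, hg.eq_sum _ (Nat.or_lt_two_pow hlt (by norm_num))]
    congr 1
    refine List.map_congr_left fun σ hσ => ?_
    have h1 : unionOver σ 1 = 1 := by
      have := hG σ hσ
      simp only [isSymmetry, Bool.and_eq_true, beq_iff_eq] at this
      exact this.1.1
    rw [unionOver_or, h1, hh.or_one (accepts_unionOver (hG σ hσ) hS)]
  have e : S ||| S % 2 ^ 8 = S := by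
    refine Nat.eq_of_testBit_eq fun i => ?_
    rw [Nat.testBit_or, Nat.testBit_mod_two_pow]
    cases S.testBit i <;> simp
  have h1 := hg.condMutualInfo_nonneg 1 S (S % 2 ^ 8)
  have h2 := hg.condMutualInfo_nonneg 1 1 S
  rw [Nat.or_assoc, e, Nat.or_comm 1, Nat.or_comm 1] at h1
  rw [Nat.or_self, Nat.or_comm 1] at h2
  linarith

theorem eval_form (hg : IsSymmetrizedExtension h G l g) (hh : IsSchemeEntropy minimal h)
    (hG : ∀ σ ∈ G, isSymmetry minimal σ) {l' : List CopyStep} (hl' : ∀ s ∈ l', s.HoldsFor g)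
    (S : ℕ) : (form minimal G l' S).eval (unknown h g) = g S := by
  induction l' generalizing S with
  | nil =>
    rw [form]
    split_ifs with h1 h2
    · simp only [LinForm.eval_flatMap, eval_baseForm hh, hg.eq_sum S h1]
    · have e1 : (2 * (S ||| 1) + 1) % 2 = 1 := by omega
      have e2 : (2 * (S ||| 1) + 1) / 2 = S ||| 1 := by omega
      simp [unknown, e1, e2, hg.or_one hh hG h2]
    · have e1 : (2 * S + 1) % 2 = 1 := by omega
      have e2 : (2 * S + 1) / 2 = S := by omega
      simp [unknown, e1, e2]
  | cons s l' ih =>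
    simp only [List.mem_cons, forall_eq_or_imp] at hl'
    replace ih := ih hl'.2
    rw [form]
    split_ifs with h1 h2 h3
    · exact ih S
    · push Not at h1
      rw [ih, (hl'.1 S h1.2).1 h2]
    · push Not at h1
      rw [LinForm.eval_append, LinForm.eval_append, LinForm.eval_smul, ih, ih, ih,
        (hl'.1 S h1.2).2 h3]
      push_cast
      ring
    · exact ih S

/-- A valid certificate proves its bound for every scheme. -/
theorem bound_le_of_isValid {c : Certificate} (hc : c.isValid) {M : VariableFamily}
    (hM : IsSchemeEntropy c.minimal M.h) (hpos : 0 < M.h 1) {ρ : ℝ}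
    (hρ : ∀ j < 7, M.h (2 ^ (j + 1)) ≤ ρ * M.h 1) :
    (c.bound : ℝ) ≤ c.totalWeight * ρ := by
  simp only [isValid, Bool.and_eq_true, List.all_eq_true, decide_eq_true_eq] at hc
  obtain ⟨⟨⟨⟨hne, hwf⟩, hG⟩, hshares⟩, hcancel⟩ := hc
  obtain ⟨g, hg⟩ := M.exists_isSymmetrizedExtension c.group hwf
  have hform : ∀ S, (form c.minimal c.group c.steps S).eval (unknown M.h g) = g S :=
    eval_form hg hM hG hg.holdsFor
  have hzero := LinForm.eval_eq_zero_of_cancels (unknown M.h g) hcancel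
  have hlen : (c.group.length : ℝ) = c.symmetries.length := by simp [group]
  have hlen_pos : (0 : ℝ) < c.symmetries.length := by exact_mod_cast hne
  have hineq : 0 ≤ LinForm.eval (unknown M.h g) (c.inequalities.flatMap fun t =>
      (c.infoForm (vars t.2.1) (vars t.2.2.1) (vars t.2.2.2)).smul (t.1 : ℤ)) := by
    rw [LinForm.eval_flatMap]
    refine List.sum_nonneg fun x hx => ?_
    obtain ⟨t, -, rfl⟩ := List.mem_map.1 hx
    have := hg.condMutualInfo_nonneg (vars t.2.1) (vars t.2.2.1) (vars t.2.2.2)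
    simp only [LinForm.eval_smul, infoForm, LinForm.eval_append, hform]
    refine mul_nonneg (by positivity) ?_
    push_cast
    linarith
  have hshare : (c.shares.map fun t => (t.1 : ℝ)).sum * -(c.symmetries.length * (ρ * M.h 1)) ≤
      LinForm.eval (unknown M.h g) (c.shares.flatMap fun t =>
        (form c.minimal c.group c.steps (2 ^ t.2)).smul (-(t.1 : ℤ))) := by
    rw [LinForm.eval_flatMap, ← List.sum_map_mul_right]
    refine List.sum_le_sum fun t ht => ?_
    rw [LinForm.eval_smul, hform]
    have hi := hshares t ht
    have h8 : 2 ^ t.2 < 2 ^ 8 := Nat.pow_lt_pow_right (by norm_num) (by omega)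
    have hle : g (2 ^ t.2) ≤ c.symmetries.length * (ρ * M.h 1) := by
      rw [hg.eq_sum _ h8, ← hlen, ← nsmul_eq_mul]
      refine (List.sum_le_card_nsmul _ (ρ * M.h 1) fun x hx => ?_).trans_eq (by simp)
      obtain ⟨σ, hσ, rfl⟩ := List.mem_map.1 hx
      have := hG σ hσ
      simp only [isSymmetry, Bool.and_eq_true, List.all_eq_true, List.any_eq_true, List.mem_range,
        beq_iff_eq] at this
      obtain ⟨j, hj, hjσ⟩ := this.2 (t.2 - 1) (by omega)
      rw [Nat.sub_add_cancel hi.1] at hjσ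
      rw [hjσ]
      exact hρ j hj
    push_cast
    rw [neg_mul, mul_neg, neg_le_neg_iff]
    exact mul_le_mul_of_nonneg_left hle (by positivity)
  have hsecret : LinForm.eval (unknown M.h g)
      [(((c.bound * c.symmetries.length : ℕ) : ℤ), 2)] =
      c.bound * c.symmetries.length * M.h 1 := by
    simp [unknown]
  rw [totalForm, LinForm.eval_append, LinForm.eval_append, hsecret] at hzero
  have hw : (c.totalWeight : ℝ) = (c.shares.map fun t => (t.1 : ℝ)).sum := by
    simp [totalWeight, Function.comp_def]
  rw [hw]
  have hk : (0 : ℝ) < c.symmetries.length * M.h 1 := mul_pos hlen_pos hpos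
  refine le_of_mul_le_mul_right ?_ hk
  linarith

end Certificate

end SecretSharing

/-! ### Certificates for the seven access structures -/

/-! In each certificate the weights are a dual solution of the linear program that minimizes the
largest entropy of a share over the symmetrized extensions by the given copies. The variables from
`8` on are the copies. -/

namespace SecretSharing

/-- The certificate for `𝒜`. -/
def certA : Certificate where
  minimalSets :=
    [0x123, 0x145, 0x167, 0x246, 0x257, 0x347, 0x356, 0x1247]
  symmetries :=
    [[1, 2, 3, 4, 5, 6, 7], [2, 4, 6, 1, 3, 5, 7], [4, 1, 5, 2, 6, 3, 7]]
  copySteps := [(8, 0x2345, [0xF, 0x1, 0x6, 0x7])]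
  shares := [(13, 1), (37, 3)]
  inequalities :=
    [(19, 0x3, 0x3, 0xF1256), (1, 0x1, 0x1, 0x23456), (6, 0x1, 0x1, 0xF247),
     (11, 0x6, 0x6, 0xF1357), (4, 0x1, 0x1, 0x23567), (1, 0x1, 0x1, 0x234567),
     (7, 0x6, 0x6, 0xF249B), (1, 0x1, 0x1, 0xF679AB), (5, 0x3, 0x1, 0), (9, 0x13, 0x2, 0),
     (6, 0x5, 0x3, 0), (12, 0x6, 0x35, 0), (3, 0x7, 0x6, 0x1), (3, 0x37, 0x4, 0),
     (1, 0x7, 0x356, 0xF124), (1, 0x249, 0x6, 0), (4, 0xA, 0x6, 0), (1, 0x28A, 0x6, 0x4),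
     (5, 0x248, 0x6, 0xA), (6, 0x8A, 0x6, 0x35), (1, 0x8A, 0x9, 0xF6), (6, 0x35, 0x24, 0xF68A),
     (1, 0x9A, 0x16, 0x34), (1, 0x9A, 0x16, 0x25), (1, 0x25, 0x34, 0x169A), (3, 0x24B, 0x6, 0),
     (7, 0x5B, 0x6, 0), (3, 0xB, 0x8A, 0xF6), (7, 0x39, 0x6, 0x5B), (7, 0x35, 0xF, 0x249B),
     (1, 0xB, 0x24, 0xF69), (3, 0x9, 0x24, 0xF6B), (3, 0xF6, 0x2, 0x9B), (3, 0x9B, 0x4, 0xF26),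
     (1, 0xAB, 0x67, 0x23), (1, 0xAB, 0x67, 0x45), (1, 0x7B, 0x19, 0x6A), (1, 0x45, 0x23, 0x67AB),
     (1, 0x7A, 0x35, 0xF69B), (1, 0x67, 0x24, 0x359AB), (2, 0x9B, 0xF6, 0x8A),
     (1, 0xB, 0xF6, 0x89A), (3, 0x9, 0xF6, 0x8AB), (6, 0x8A, 0x35, 0xF69B),
     (6, 0x68, 0x24, 0x359AB)]
  bound := 57

/-- The certificate for `𝒜*`. -/
def certAStar : Certificate where
  minimalSets :=
    [0x123, 0x145, 0x167, 0x246, 0x257, 0x347, 0x1356, 0x2356, 0x3456, 0x3567]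
  symmetries :=
    [[1, 2, 3, 4, 5, 6, 7], [2, 4, 6, 1, 3, 5, 7], [4, 1, 5, 2, 6, 3, 7]]
  copySteps := [(8, 0x1247, [0xF3, 0x35])]
  shares := [(19, 1), (21, 3), (5, 7)]
  inequalities :=
    [(4, 0x3, 0x3, 0xF1256), (4, 0x1, 0x1, 0x23456), (17, 0x3, 0x3, 0xF1247),
     (5, 0x4, 0x4, 0xF1357), (1, 0x7, 0x7, 0xF2345), (1, 0x1, 0x1, 0x23457),
     (5, 0x2, 0x2, 0x13457), (4, 0x7, 0x7, 0x123456), (4, 0x2, 0x2, 0xF45678), (5, 0x3, 0x2, 0),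
     (7, 0x3, 0x12, 0), (5, 0x23, 0x1, 0), (4, 0x356, 0x1, 0), (5, 0x7, 0x3, 0),
     (7, 0x17, 0x6, 0), (5, 0x37, 0x4, 0), (4, 0x5, 0x3, 0xF1247), (6, 0x128, 0x3, 0),
     (6, 0x8, 0x56, 0x12), (4, 0x68, 0x3, 0x5), (2, 0x8, 0x3, 0x56), (6, 0x56, 0xF, 0x38),
     (4, 0x8, 0x2, 0xF356), (2, 0x8, 0x1247, 0xF356), (4, 0x3, 0x1, 0x2568),
     (4, 0x38, 0x47, 0xF1256), (6, 0x8, 0x56, 0x47), (6, 0x47, 0x3, 0x8), (6, 0x47, 0x12, 0xF38),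
     (4, 0x47, 0x2, 0x568), (2, 0x47, 0x12, 0x568), (4, 0x8, 0x12, 0xF4567), (1, 0x9, 0x35, 0x24),
     (1, 0x249, 0x6, 0), (1, 0x9, 0x6, 0x35), (1, 0x35, 0xF, 0x69), (1, 0x9, 0x1247, 0xF356),
     (1, 0x9, 0x35, 0x17), (1, 0x17, 0x6, 0x9), (1, 0x17, 0x24, 0x359), (1, 0x17, 0x24, 0xF69)]
  bound := 52

/-- The certificate for `ℱ`. -/
def certF : Certificate where
  minimalSets :=
    [0x123, 0x145, 0x167, 0x246, 0x257, 0x347, 0x356, 0x1247, 0x1256]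
  symmetries :=
    [[1, 2, 3, 4, 5, 6, 7], [1, 2, 3, 6, 7, 4, 5]]
  copySteps := [(8, 0x2345, [0xF, 0x6])]
  shares := [(3, 2), (2, 3), (10, 4)]
  inequalities :=
    [(1, 0x3, 0x3, 0xF256), (1, 0x4, 0x4, 0x2356), (3, 0x6, 0x6, 0xF2345), (1, 0x3, 0x3, 0xF457),
     (1, 0x2, 0x2, 0x3457), (2, 0x6, 0x6, 0xF13578), (2, 0x9, 0x9, 0xF1478),
     (2, 0x2, 0x2, 0xF14789), (2, 0x9, 0x9, 0x135678), (1, 0x15, 0x4, 0), (1, 0x4, 0x1, 0x5),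
     (2, 0x6, 0x4, 0), (1, 0x6, 0x5, 0), (3, 0x46, 0x2, 0), (2, 0x56, 0x3, 0),
     (2, 0x8, 0x235, 0xF147), (2, 0x8, 0x24, 0xF1357), (2, 0x9, 0x1357, 0), (1, 0x9, 0x7, 0x45),
     (1, 0x9, 0x2, 0x47), (2, 0x2489, 0x6, 0), (1, 0x8, 0x7, 0x249), (2, 0x3589, 0x6, 0),
     (2, 0x8, 0x17, 0x359), (2, 0x89, 0x17, 0xF6), (2, 0x35, 0x24, 0xF689), (2, 0x89, 0x4, 0x17),
     (1, 0x8, 0x5, 0x479), (1, 0x17, 0x2, 0x489), (1, 0x2, 0x1, 0x4789), (1, 0x7, 0x23, 0x4589),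
     (2, 0x6, 0x35, 0x1789)]
  bound := 17

/-- The certificate for `ℱ*`. -/
def certFStar : Certificate where
  minimalSets :=
    [0x123, 0x145, 0x167, 0x246, 0x257, 0x1347, 0x1356, 0x2347, 0x2356, 0x3456, 0x3457, 0x3467,
     0x3567]
  symmetries :=
    [[1, 2, 3, 4, 5, 6, 7], [1, 2, 3, 7, 6, 5, 4]]
  copySteps := [(8, 0x1256, [0xF4])]
  shares := [(1, 1), (1, 2), (3, 4), (2, 5)]
  inequalities :=
    [(1, 0x1, 0x1, 0xF2345), (1, 0x2, 0x2, 0xF1346), (3, 0x4, 0x4, 0xF1256),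
     (1, 0x5, 0x5, 0x12346), (1, 0x6, 0x6, 0x12345), (1, 0x34, 0x1, 0), (1, 0x3, 0x2, 0x14),
     (1, 0x5, 0x14, 0), (1, 0x15, 0x4, 0), (1, 0x6, 0x4, 0), (1, 0x26, 0x4, 0), (1, 0x46, 0x2, 0),
     (1, 0x56, 0x3, 0xF124), (1, 0x8, 0x37, 0x15), (1, 0x15, 0x4, 0x8), (1, 0x268, 0x4, 0),
     (1, 0x8, 0x37, 0x26), (1, 0x26, 0x15, 0xF48), (1, 0x8, 0x4, 0x37), (1, 0x37, 0xF, 0x48),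
     (1, 0x8, 0x1256, 0xF347), (1, 0x26, 0x15, 0x378)]
  bound := 8

/-- The certificate for `ℱ̂`. -/
def certFHat : Certificate where
  minimalSets :=
    [0x123, 0x145, 0x167, 0x246, 0x257, 0x347, 0x1256, 0x1356, 0x2356, 0x3456, 0x3567]
  symmetries :=
    [[1, 2, 3, 4, 5, 6, 7], [1, 2, 3, 7, 6, 5, 4]]
  copySteps := [(8, 0x2345, [0xF7, 0x17])]
  shares := [(2, 2), (1, 3), (11, 4), (6, 5)]
  inequalities :=
    [(1, 0x5, 0x5, 0xF1247), (3, 0x4, 0x4, 0xF1357), (8, 0x7, 0x7, 0xF2345),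
     (2, 0x2, 0x2, 0x13457), (1, 0x5, 0x5, 0x12467), (1, 0x3, 0x3, 0x124567),
     (2, 0x5, 0x5, 0x123467), (1, 0x5, 0x5, 0xF1268), (1, 0x6, 0x6, 0xF3459), (2, 0x4, 0x3, 0),
     (1, 0x5, 0x14, 0), (1, 0x15, 0x4, 0), (1, 0x6, 0x4, 0), (2, 0x6, 0x24, 0), (2, 0x46, 0x2, 0),
     (1, 0x356, 0x4, 0), (4, 0x7, 0x34, 0), (2, 0x8, 0x16, 0x34), (2, 0x348, 0x7, 0),
     (2, 0x258, 0x7, 0), (1, 0x168, 0x5, 0), (1, 0x8, 0x2, 0x16), (1, 0x16, 0x5, 0x28),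
     (1, 0x8, 0x4, 0xF126), (2, 0x34, 0xF, 0x168), (2, 0x8, 0x25, 0xF1346), (1, 0x16, 0x2, 0x58),
     (2, 0x8, 0x16, 0xF7), (2, 0x25, 0x34, 0xF78), (1, 0x7, 0x24, 0xF168), (1, 0x7, 0x25, 0xF168),
     (1, 0x68, 0x35, 0xF1247), (1, 0x68, 0x34, 0x1257), (1, 0x9, 0x17, 0x24), (1, 0x59, 0x6, 0x3),
     (1, 0x9, 0x17, 0x35), (1, 0x2, 0xF, 0x3459), (1, 0x6, 0x24, 0x9), (1, 0x35, 0xF, 0x69),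
     (1, 0x9, 0x4, 0xF356), (1, 0x179, 0x6, 0), (1, 0x35, 0x24, 0x179), (1, 0x17, 0x24, 0xF69),
     (1, 0x69, 0x35, 0xF1247)]
  bound := 23

/-- The certificate for `𝒬`. -/
def certQ : Certificate where
  minimalSets :=
    [0x123, 0x145, 0x167, 0x246, 0x257, 0x347, 0x1247, 0x1256, 0x1356, 0x2356, 0x3456, 0x3567]
  symmetries :=
    [[1, 2, 3, 4, 5, 6, 7]]
  copySteps := [(9, 0x23458, [0xF7]), (8, 0x2345, [0xF7])]
  shares := [(1, 2), (2, 5), (1, 6), (11, 7)]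
  inequalities :=
    [(1, 0x2, 0x2, 0xF1346), (1, 0x6, 0x6, 0x12345), (9, 0x7, 0x7, 0xF2345),
     (1, 0x7, 0x7, 0x12346), (1, 0x5, 0x5, 0x123467), (1, 0x7, 0x7, 0x123456),
     (1, 0x5, 0x5, 0xF12689), (1, 0x5, 0x2, 0), (3, 0x7, 0x34, 0), (2, 0x7, 0x25, 0),
     (1, 0x7, 0x16, 0), (1, 0x17, 0x6, 0), (1, 0x27, 0x5, 0), (1, 0x8, 0x16, 0x34),
     (2, 0x348, 0x7, 0), (2, 0x258, 0x7, 0), (1, 0x8, 0x2, 0x16), (1, 0x16, 0x5, 0x28),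
     (1, 0x8, 0x16, 0xF7), (1, 0x7, 0x34, 0x168), (1, 0x78, 0x25, 0xF1346), (1, 0x259, 0x1, 0x34),
     (1, 0x349, 0x68, 0xF125), (1, 0x89, 0x16, 0x34), (1, 0x3489, 0x7, 0), (1, 0x89, 0x1, 0x25),
     (1, 0x2589, 0x7, 0), (1, 0x6, 0x25, 0x189), (1, 0x89, 0x345, 0xF126), (1, 0xF7, 0x1, 0x89),
     (1, 0x89, 0x6, 0xF17), (1, 0x25, 0x34, 0xF789), (1, 0x7, 0x34, 0x1689),
     (1, 0x6789, 0x25, 0xF134)]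
  bound := 17

/-- The certificate for `𝒬*`. -/
def certQStar : Certificate where
  minimalSets :=
    [0x123, 0x145, 0x167, 0x246, 0x257, 0x1247, 0x1347, 0x1356, 0x2347, 0x2356, 0x3456, 0x3457,
     0x3467, 0x3567]
  symmetries :=
    [[1, 2, 3, 4, 5, 6, 7], [1, 2, 3, 7, 6, 5, 4]]
  copySteps := [(8, 0x1256, [0xF4])]
  shares := [(1, 1), (1, 2), (3, 4), (2, 5)]
  inequalities :=
    [(1, 0x1, 0x1, 0xF2345), (1, 0x2, 0x2, 0xF1346), (3, 0x4, 0x4, 0xF1256),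
     (1, 0x5, 0x5, 0x12346), (1, 0x6, 0x6, 0x12345), (1, 0x5, 0x1, 0), (1, 0x5, 0x2, 0),
     (2, 0x15, 0x4, 0), (2, 0x26, 0x4, 0), (1, 0x56, 0x3, 0x4), (1, 0x3, 0x12, 0xF456),
     (1, 0x158, 0x4, 0), (1, 0x8, 0x37, 0x15), (1, 0x8, 0x37, 0x26), (1, 0x26, 0x4, 0x8),
     (1, 0x26, 0x15, 0xF48), (1, 0x8, 0x4, 0x37), (1, 0x37, 0xF, 0x48), (1, 0x8, 0x1256, 0xF347),
     (1, 0x26, 0x15, 0x378)]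
  bound := 8

theorem certFStar_isValid : certFStar.isValid = true := by decide +kernel

theorem certQStar_isValid : certQStar.isValid = true := by decide +kernel

theorem certF_isValid : certF.isValid = true := by decide +kernel

theorem certFHat_isValid : certFHat.isValid = true := by decide +kernel

theorem certQ_isValid : certQ.isValid = true := by decide +kernel

theorem certAStar_isValid : certAStar.isValid = true := by decide +kernel

theorem certA_isValid : certA.isValid = true := by decide +kernel

end SecretSharing

/-! ### Entropy functions of secret sharing schemes -/

namespace SecretSharing

/-- The elements of a bit mask among the first eight variables. -/
def indexSet (S : ℕ) : Finset (Fin 8) := Finset.univ.filter fun i => S.testBit i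

/-- The random variables of a joint distribution on the space of all their values. The variables
with an index beyond the range are constant. -/
noncomputable def JointDistribution.toFamily (s : JointDistribution (Fin 8)) : VariableFamily where
  Ω := ∀ i, s.range i
  fintype := inferInstance
  p x := (s.law x).toReal
  p_nonneg _ := ENNReal.toReal_nonneg
  r i := if hi : i < 8 then Setoid.ker fun x => x ⟨i, hi⟩ else ⊤

lemma JointDistribution.h_toFamily (s : JointDistribution (Fin 8)) (S : ℕ) :
    s.toFamily.h S = s.H (indexSet S) := by
  have hrel : s.toFamily.rel S =
      Setoid.ker (fun (x : ∀ i, s.range i) (i : indexSet S) => x i) := by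
    refine Setoid.ext fun x y => ?_
    have hr : ∀ i (hi : i < 8), s.toFamily.r i x y ↔ x ⟨i, hi⟩ = y ⟨i, hi⟩ := by
      intro i hi
      change (if hi : i < 8 then Setoid.ker (fun x : ∀ i, s.range i => x ⟨i, hi⟩) else ⊤) x y ↔ _
      rw [dif_pos hi]
      rfl
    constructor
    · intro h
      refine funext fun i => (hr i.1 i.1.2).1 (h i.1 ?_)
      simpa [indexSet] using i.2
    · intro h i hi
      by_cases hi8 : i < 8
      · exact (hr i hi8).2 (congrFun h ⟨⟨i, hi8⟩, by simpa [indexSet] using hi⟩)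
      · change (if hi : i < 8 then Setoid.ker (fun x : ∀ i, s.range i => x ⟨i, hi⟩) else ⊤) x y
        rw [dif_neg hi8]
        trivial
  unfold VariableFamily.h
  rw [hrel]
  exact (entropy_map s.law _).symm

lemma JointDistribution.H_empty {ι : Type} [DecidableEq ι] (s : JointDistribution ι) :
    s.H ∅ = 0 := by
  have : ∀ a, (s.marginal ∅) a = 1 := fun a => by
    rw [← (s.marginal ∅).tsum_coe, tsum_fintype, Fintype.sum_subsingleton _ a]
  simp [JointDistribution.H, entropy, this]

section Scheme

variable {minimal : List ℕ}

lemma indexSet_subset_iff {S T : ℕ} (hS : S < 2 ^ 8) :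
    indexSet S ⊆ indexSet T ↔ S &&& T = S := by
  rw [and_eq_left_iff]
  constructor
  · intro h i hi
    have hi8 : i < 8 := (Nat.pow_lt_pow_iff_right (by norm_num)).1
      ((Nat.ge_two_pow_of_testBit hi).trans_lt hS)
    simpa [indexSet] using h (show (⟨i, hi8⟩ : Fin 8) ∈ indexSet S by simpa [indexSet] using hi)
  · intro h i hi
    simp only [indexSet, Finset.mem_filter, Finset.mem_univ, true_and] at hi ⊢
    exact h i hi

/-- The set of participants with the shares in the even bit mask `2 * q`. -/
lemma exists_map_succEmb (q : ℕ) : ∃ J : Finset (Fin 7),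
    J.map (Fin.succEmb 7) = indexSet (2 * q) ∧
      {0} ∪ J.map (Fin.succEmb 7) = indexSet (2 * q + 1) := by
  have h : (Finset.univ.filter fun i : Fin 7 => q.testBit i).map (Fin.succEmb 7) =
      indexSet (2 * q) := by
    ext i
    refine Fin.cases ?_ (fun j => ?_) i
    · simp [indexSet]
    · simp [indexSet, Nat.testBit_succ]
  refine ⟨_, h, ?_⟩
  rw [h]
  ext i
  refine Fin.cases ?_ (fun j => ?_) i
  · simp [indexSet]
  · have : (2 * q + 1) / 2 = q := by omega
    simp [indexSet, Nat.testBit_succ, this]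

lemma Scheme.isSchemeEntropy (hlt : ∀ m ∈ minimal, m < 2 ^ 8)
    (s : Scheme (AccessStructure.ofMinimal (minimal.map indexSet).toFinset)) :
    IsSchemeEntropy minimal s.toJointDistribution.toFamily.h := by
  have hone : indexSet 1 = {0} := by decide
  have hacc : ∀ (q : ℕ) (J : Finset (Fin 7)), J.map (Fin.succEmb 7) = indexSet (2 * q) →
      (J ∈ (AccessStructure.ofMinimal (minimal.map indexSet).toFinset).accepted ↔
        accepts minimal (2 * q) = true) := by
    intro q J hJ
    rw [Certificate.accepts_iff]
    simp only [AccessStructure.ofMinimal, Set.mem_ofPred_eq, hJ, List.mem_toFinset, List.mem_map,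
      exists_exists_and_eq_and]
    exact exists_congr fun m => and_congr_right fun hm => indexSet_subset_iff (hlt m hm)
  refine ⟨?_, fun q hq => ?_, fun q hq => ?_⟩
  · rw [JointDistribution.h_toFamily, ← JointDistribution.H_empty s.toJointDistribution]
    rfl
  all_goals
    obtain ⟨J, hJ, hJ'⟩ := exists_map_succEmb q
    simp only [JointDistribution.h_toFamily, hone, ← hJ, ← hJ']
  · have := s.of_accepted J ((hacc q J hJ).2 hq)
    unfold JointDistribution.condH at this
    linarith
  · have := s.of_not_accepted J (fun h => by simp [(hacc q J hJ).1 h] at hq)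
    unfold JointDistribution.condH at this
    linarith

/-- A valid certificate bounds the information ratio of the access structure. -/
theorem Certificate.le_informationRatio {c : Certificate} (hc : c.isValid)
    {sets : Finset (Finset (Fin 8))} (hsets : sets = (c.minimal.map indexSet).toFinset)
    (hlt : ∀ m ∈ c.minimal, m < 2 ^ 8) (hw : 0 < c.totalWeight) {r : ℝ}
    (hr : r * c.totalWeight ≤ c.bound) :
    (r : EReal) ≤ (AccessStructure.ofMinimal sets).informationRatio := by
  subst hsets
  refine le_iInf fun s => EReal.coe_le_coe_iff.2 ?_
  have hone : indexSet 1 = {0} := by decide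
  have hpos := s.secret_pos
  have hρ : ∀ j < 7, s.toJointDistribution.toFamily.h (2 ^ (j + 1)) ≤
      s.informationRatio * s.toJointDistribution.toFamily.h 1 := by
    intro j hj
    have hj' : indexSet (2 ^ (j + 1)) = {(⟨j, hj⟩ : Fin 7).succ} := by
      decide +revert
    rw [JointDistribution.h_toFamily, JointDistribution.h_toFamily, hone, hj', ← div_le_iff₀ hpos]
    exact le_ciSup (f := fun i : Fin 7 => s.H {i.succ} / s.H {0}) (Set.finite_range _).bddAbove _
  have := bound_le_of_isValid hc (s.isSchemeEntropy hlt)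
    (by rwa [JointDistribution.h_toFamily, hone]) hρ
  refine le_of_mul_le_mul_right ?_ (show (0 : ℝ) < c.totalWeight by exact_mod_cast hw)
  linarith

end Scheme

end SecretSharing

/-! ### The lower bounds -/

open SecretSharing AccessStructure in
theorem mainTheorem1 :
    ((57 / 50 : ℝ) : EReal) ≤ portA.informationRatio ∧
    ((52 / 45 : ℝ) : EReal) ≤ portAStar.informationRatio ∧
    ((17 / 15 : ℝ) : EReal) ≤ portF.informationRatio ∧
    ((8 / 7 : ℝ) : EReal) ≤ portFStar.informationRatio ∧
    ((23 / 20 : ℝ) : EReal) ≤ portFHat.informationRatio ∧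
    ((17 / 15 : ℝ) : EReal) ≤ portQ.informationRatio ∧
    ((8 / 7 : ℝ) : EReal) ≤ portQStar.informationRatio := by
  refine ⟨Certificate.le_informationRatio certA_isValid (by decide +kernel) (by decide +kernel)
      (by decide +kernel) ?_,
    Certificate.le_informationRatio certAStar_isValid (by decide +kernel) (by decide +kernel)
      (by decide +kernel) ?_,
    Certificate.le_informationRatio certF_isValid (by decide +kernel) (by decide +kernel)
      (by decide +kernel) ?_,
    Certificate.le_informationRatio certFStar_isValid (by decide +kernel) (by decide +kernel)
      (by decide +kernel) ?_,
    Certificate.le_informationRatio certFHat_isValid (by decide +kernel) (by decide +kernel)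
      (by decide +kernel) ?_,
    Certificate.le_informationRatio certQ_isValid (by decide +kernel) (by decide +kernel)
      (by decide +kernel) ?_,
    Certificate.le_informationRatio certQStar_isValid (by decide +kernel) (by decide +kernel)
      (by decide +kernel) ?_⟩
  all_goals
    norm_num [Certificate.totalWeight, certA, certAStar, certF, certFStar, certFHat,
      certQ, certQStar]
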